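/- Let $G$ be a countable group with identity $e$, and let $\mu$ be a probability measure on $G$ whose support generates $G$. On the product space $(\Omega,\mathbb P)=(G^{\mathbb N},\mu^{\mathbb N})$ let $X_1,X_2,\dots$ be the coordinate maps, so that they are independent with common law $\mu$, and let $S_0=e$, $S_n=S_{n-1}X_n$ for $n\ge 1$. Let $R_n=\{S_0,S_1,\dots,S_n\}$ be the range. Let $\Gamma_n=(R_n,\vec E_n,W_n)$ be the weighted digraph with vertex set $R_n$, edge set $\vec E_n=\{(S_i,S_{i+1}):0\le i<n\}$ and weights $W_n(x,y)=\#\{0\le i<n: S_i=x,\ S_{i+1}=y\}$ for $(x,y)\in\vec E_n$. For a discrete random element $Y$ write $H(Y)=-\sum_y\mathbb P(Y=y)\ln\mathbb P(Y=y)\in[0,\infty]$, with $0\ln 0=0$, and $p_Y(y)=\mathbb P(Y=y)$. Assume $0<H(X_1)<\infty$. Then there is a constant $h$ with $0\le h\le H(X_1)$ such that $$\lim_{n\to\infty}\frac{H(R_n)}{n}=\lim_{n\to\infty}\frac{H(R_n,S_n)}{n}=h$$ and, almost surely, $$\lim_{n\to\infty}\frac{-\ln p_{R_n}(R_n)}{n}=\lim_{n\to\infty}\frac{-\ln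 p_{(R_n,S_n)}(R_n,S_n)}{n}=h .$$ Likewise there is a constant $h'$ with $0\le h'\le H(X_1)$, possibly different from $h$, such that $$\lim_{n\to\infty}\frac{H(\Gamma_n)}{n}=\lim_{n\to\infty}\frac{H(\Gamma_n,S_n)}{n}=h'$$ and, almost surely, $$\lim_{n\to\infty}\frac{-\ln p_{\Gamma_n}(\Gamma_n)}{n}=\lim_{n\to\infty}\frac{-\ln p_{(\Gamma_n,S_n)}(\Gamma_n,S_n)}{n}=h' .$$ -/

import Mathlib

open MeasureTheory Filter
open scoped Topology ENNReal NNReal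

namespace RangeEntropy

section Entropy

variable {Ω α : Type*} [MeasurableSpace Ω]

/-- The probability `P (Y = y)`. -/
noncomputable def prob (P : Measure Ω) (Y : Ω → α) (y : α) : ℝ :=
  P.real {ω | Y ω = y}

/-- The Shannon entropy `-∑ y, P (Y = y) ln P (Y = y)` of a discrete random element, as an
extended non-negative number (all summands are non-negative for a probability measure `P`;
`Real.negMulLog x = -x * log x`, with value `0` at `x = 0`). -/
noncomputable def entropy (P : Measure Ω) (Y : Ω → α) : ℝ≥0∞ :=
  ∑' y, ENNReal.ofReal (Real.negMulLog (prob P Y y))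

end Entropy

/-- A digraph on a set of vertices in `V` with a natural number weight on each edge. The weight
function on the edges is recorded through its extension by zero to all ordered pairs. -/
@[ext]
structure WeightedDigraph (V : Type*) where
  verts : Set V
  edges : Set (V × V)
  weight : V × V → ℕ
  edges_subset : edges ⊆ verts ×ˢ verts
  weight_eq_zero : ∀ a, a ∉ edges → weight a = 0

section Walk

variable {G : Type*} [Group G]

/-- The law `μ^ℕ` on the space `G^ℕ` of sequences of increments. -/
noncomputable def pathMeasure [MeasurableSpace G] (μ : Measure G) [IsProbabilityMeasure μ] :
    Measure (ℕ → G) :=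
  Measure.infinitePi (fun _ : ℕ => μ)

/-- The first increment `X₁`. Coordinates are counted from `0`, so that the increment
`X_{n+1}` is the coordinate `ω n`. -/
def firstStep (ω : ℕ → G) : G := ω 0

/-- The random walk: `S₀ = e` and `S_{n+1} = S_n X_{n+1}`. -/
def walk : ℕ → (ℕ → G) → G
  | 0, _ => 1
  | n + 1, ω => walk n ω * ω n

/-- The range `R_n`. -/
def walkRange (n : ℕ) (ω : ℕ → G) : Set G :=
  {g | ∃ i ≤ n, walk i ω = g}

open Classical in
/-- The weighted digraph `Γ_n` traced by the first `n` steps: its vertex set is `R_n`, its edges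
are the pairs `(S_i, S_{i+1})` with `i < n`, and an edge is weighted by the number of times it is
traversed. -/
noncomputable def walkDigraph (n : ℕ) (ω : ℕ → G) : WeightedDigraph G where
  verts := walkRange n ω
  edges := {a | ∃ i < n, walk i ω = a.1 ∧ walk (i + 1) ω = a.2}
  weight a := ∑ i ∈ Finset.range n, if walk i ω = a.1 ∧ walk (i + 1) ω = a.2 then 1 else 0
  edges_subset := by
    rintro ⟨x, y⟩ ⟨i, hi, hx, hy⟩
    exact ⟨⟨i, hi.le, hx⟩, ⟨i + 1, hi, hy⟩⟩
  weight_eq_zero := by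
    intro a ha
    refine Finset.sum_eq_zero fun i hi => if_neg fun h => ha ?_
    exact ⟨i, Finset.mem_range.mp hi, h⟩

end Walk

end RangeEntropy

/-!
The pair `Z n = (R n, S n)` (and likewise `(Γ n, S n)`) is assembled from independent pieces: the
range of the first `m + n` steps is the union of the range of the first `m` steps and the translate
by `S m` of the range of the next `n` steps. So `Z (m + n)` is a function of `Z m` and of `Z n`
evaluated on the shifted increments, which are independent, and the information
`I n = -ln p (Z n)` satisfies `I (m + n) ≤ I m + I n ∘ shift^m` almost surely (`ae_info_add_le`).
Also `I 1` is dominated by the information of the first increment, hence integrable. Kingman's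
subadditive ergodic theorem for the Bernoulli shift then gives `I n / n → h` almost surely and in
mean, where `h` is the infimum of the mean rates (`exists_info_rate`).

Kingman's theorem is proved here for non-negative processes (`tendsto_of_ae_subadditive`). The upper
bound comes from cutting time into blocks of a fixed length and applying the strong law of large
numbers to the independent blocks. The lower bound is the covering argument of Katznelson and
Weiss: if `a n / n` fell below `c` infinitely often with positive probability, then by ergodicity it
would do so almost surely, almost every orbit could be covered up to a small proportion by blocks of
average at most `c`, and the mean rate would be at most `c`.

The endpoint is then forgotten (`tendsto_of_tendsto_prod`): given `R n`, the position `S n` has at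
most `n + 1` possible values, so the inverse conditional probability `p (R n) / p (R n, S n)` has
mean at most `n + 1`, and by summability it is eventually at most `(n + 1) ^ 3`; hence the two
informations differ by `O(ln n)`. Fatou's lemma carries the almost sure limit over to the entropies,
which are bounded above by those of the pairs.
-/

namespace RangeEntropy

open ProbabilityTheory

/-! ### Kingman's theorem for non-negative processes -/

section Kingman

variable {Ω : Type*} {T : Ω → Ω} {a : ℕ → Ω → ℝ}

/-- The orbit of `ω` under `T` satisfies all subadditivity inequalities for `a`. -/
def SubadditiveOn (T : Ω → Ω) (a : ℕ → Ω → ℝ) (ω : Ω) : Prop :=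
  ∀ i m n, a (m + n) (T^[i] ω) ≤ a m (T^[i] ω) + a n (T^[i + m] ω)

lemma SubadditiveOn.add_le {ω : Ω} (h : SubadditiveOn T a ω) (m n : ℕ) :
    a (m + n) ω ≤ a m ω + a n (T^[m] ω) := by
  simpa using h 0 m n

lemma SubadditiveOn.iterate {ω : Ω} (h : SubadditiveOn T a ω) (k : ℕ) :
    SubadditiveOn T a (T^[k] ω) := by
  intro i m n
  have := h (i + k) m n
  rw [← Function.iterate_add_apply, ← Function.iterate_add_apply]
  convert this using 4
  omega

lemma SubadditiveOn.le_sum_blocks {ω : Ω} (h : SubadditiveOn T a ω) (h0 : ∀ ω, a 0 ω = 0)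
    (k q : ℕ) : a (k * q) ω ≤ ∑ j ∈ Finset.range q, a k (T^[k * j] ω) := by
  induction q with
  | zero => simp [h0]
  | succ q ih =>
    rw [Finset.sum_range_succ, Nat.mul_succ]
    linarith [h.add_le (k * q) k]

lemma SubadditiveOn.le_sum_one {ω : Ω} (h : SubadditiveOn T a ω) (h0 : ∀ ω, a 0 ω = 0)
    (n : ℕ) : a n ω ≤ ∑ j ∈ Finset.range n, a 1 (T^[j] ω) := by
  simpa using h.le_sum_blocks h0 1 n

/-- Cutting `[0, n)` into blocks of length `k` bounds `a n` by a block sum, up to a sum of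
fewer than `k` values of `a 1`. -/
lemma SubadditiveOn.le_blocks_add {ω : Ω} (h : SubadditiveOn T a ω) (h0 : ∀ ω, a 0 ω = 0)
    (hnn : ∀ n ω, 0 ≤ a n ω) {k : ℕ} (hk : 0 < k) (n : ℕ) :
    a n ω ≤ ∑ j ∈ Finset.range (n / k), a k (T^[k * j] ω) +
      (∑ j ∈ Finset.range (k * (n / k + 1)), a 1 (T^[j] ω) -
        ∑ j ∈ Finset.range (k * (n / k)), a 1 (T^[j] ω)) := by
  have h1 := h.add_le (k * (n / k)) (n % k)
  rw [Nat.div_add_mod] at h1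
  have h2 := h.le_sum_blocks h0 k (n / k)
  have h3 := (h.iterate (k * (n / k))).le_sum_one h0 (n % k)
  have h4 : ∑ j ∈ Finset.range (n % k), a 1 (T^[j] (T^[k * (n / k)] ω)) ≤
      ∑ j ∈ Finset.range k, a 1 (T^[j] (T^[k * (n / k)] ω)) :=
    Finset.sum_le_sum_of_subset_of_nonneg
      (Finset.range_subset_range.2 (Nat.mod_lt _ hk).le) fun _ _ _ => hnn _ _
  have h5 : ∑ j ∈ Finset.range (k * (n / k + 1)), a 1 (T^[j] ω) =
      ∑ j ∈ Finset.range (k * (n / k)), a 1 (T^[j] ω) +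
        ∑ j ∈ Finset.range k, a 1 (T^[j] (T^[k * (n / k)] ω)) := by
    rw [Nat.mul_succ, Finset.sum_range_add]
    simp only [← Function.iterate_add_apply, add_comm]
  linarith

/-- Along an orbit on which the averages of `a k` over blocks of length `k` tend to `H`, the upper
growth rate of `a` is at most `H / k`. -/
lemma SubadditiveOn.eventually_le {ω : Ω} (h : SubadditiveOn T a ω) (h0 : ∀ ω, a 0 ω = 0)
    (hnn : ∀ n ω, 0 ≤ a n ω) {k : ℕ} (hk : 0 < k) {H m c : ℝ}
    (hH : Tendsto (fun q : ℕ => (∑ j ∈ Finset.range q, a k (T^[k * j] ω)) / q) atTop (𝓝 H))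
    (hm : Tendsto (fun q : ℕ => (∑ j ∈ Finset.range q, a 1 (T^[j] ω)) / q) atTop (𝓝 m))
    (hc0 : 0 ≤ c) (hc : H < c * k) : ∀ᶠ n : ℕ in atTop, a n ω ≤ c * n := by
  set M : ℕ → ℝ := fun q => ∑ j ∈ Finset.range q, a 1 (T^[j] ω) with hM
  have hk' : (0 : ℝ) < k := by exact_mod_cast hk
  have e1 : Tendsto (fun q : ℕ => M (k * q) / q) atTop (𝓝 (m * k)) := by
    have := (hm.comp (tendsto_id.const_mul_atTop' hk)).mul_const (k : ℝ)
    refine this.congr' ?_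
    filter_upwards [eventually_gt_atTop 0] with q hq
    have hq' : (0 : ℝ) < q := by exact_mod_cast hq
    simp only [Function.comp, id, Nat.cast_mul, hM]
    field_simp
  have e2 : Tendsto (fun q : ℕ => M (k * (q + 1)) / q) atTop (𝓝 (m * k)) := by
    have h1 : Tendsto (fun q : ℕ => ((q : ℝ) + 1) / q) atTop (𝓝 1) := by
      have : Tendsto (fun q : ℕ => 1 + 1 / (q : ℝ)) atTop (𝓝 (1 + 0)) :=
        tendsto_const_nhds.add tendsto_one_div_atTop_nhds_zero_nat
      rw [add_zero] at this
      refine this.congr' ?_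
      filter_upwards [eventually_gt_atTop 0] with q hq
      have hq' : (0 : ℝ) < q := by exact_mod_cast hq
      field_simp
    have := ((tendsto_add_atTop_iff_nat 1).2 e1).mul h1
    rw [mul_one] at this
    refine this.congr' ?_
    filter_upwards [eventually_gt_atTop 0] with q hq
    have hq' : (0 : ℝ) < q := by exact_mod_cast hq
    push_cast
    field_simp
  have e3 := hH.add (e2.sub e1)
  rw [sub_self, add_zero] at e3
  have e4 := (Nat.tendsto_div_const_atTop hk.ne').eventually
    ((e3.eventually_lt_const hc).and (eventually_gt_atTop 0))
  filter_upwards [e4] with n hn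
  obtain ⟨hn1, hn2⟩ := hn
  have hq : (0 : ℝ) < (n / k : ℕ) := by exact_mod_cast hn2
  have h1 := h.le_blocks_add h0 hnn hk n
  rw [← sub_div, ← add_div, div_lt_iff₀ hq] at hn1
  have h2 : ((n / k : ℕ) : ℝ) * k ≤ n := by exact_mod_cast Nat.div_mul_le_self n k
  calc a n ω ≤ _ := h1
    _ ≤ c * k * (n / k : ℕ) := hn1.le
    _ = c * ((n / k : ℕ) * k) := by ring
    _ ≤ c * n := by gcongr

/-- The set of points at which no initial block of length at most `N` has average at most `c`. -/
def slowSet (a : ℕ → Ω → ℝ) (c : ℝ) (N : ℕ) : Set Ω :=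
  {ω | ∀ n, 1 ≤ n → n ≤ N → c * n < a n ω}

open Classical in
/-- The cost of covering the site `i` of `[0, n)` by a single step: it is paid where the orbit
lies in the slow set, and near the right end of the interval. -/
noncomputable def coverCost (T : Ω → Ω) (a : ℕ → Ω → ℝ) (c : ℝ) (N n i : ℕ) (ω : Ω) : ℝ :=
  (slowSet a c N).indicator (a 1) (T^[i] ω) + if n ≤ i + N then a 1 (T^[i] ω) else 0

lemma coverCost_nonneg (hnn : ∀ n ω, 0 ≤ a n ω) (c : ℝ) (N n i : ℕ) (ω : Ω) :
    0 ≤ coverCost T a c N n i ω := by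
  unfold coverCost
  refine add_nonneg (Set.indicator_nonneg (fun _ _ => hnn _ _) _) ?_
  split_ifs
  exacts [hnn _ _, le_rfl]

lemma sum_coverCost_add (c : ℝ) (N n k : ℕ) (ω : Ω) :
    ∑ i ∈ Finset.range (k + n), coverCost T a c N (k + n) i ω =
      ∑ i ∈ Finset.range k, coverCost T a c N (k + n) i ω +
        ∑ i ∈ Finset.range n, coverCost T a c N n i (T^[k] ω) := by
  rw [Finset.sum_range_add]
  congr 1
  refine Finset.sum_congr rfl fun i _ => ?_
  simp only [coverCost, ← Function.iterate_add_apply, add_comm k i]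
  congr 1
  have : k + n ≤ i + k + N ↔ n ≤ i + N := by omega
  simp only [this]

/-- The covering argument: walking along the orbit, jump over a block of average at most `c`
whenever there is one of length at most `N`, and make a single step otherwise. -/
lemma SubadditiveOn.le_add_sum_coverCost (h0 : ∀ ω, a 0 ω = 0) (hnn : ∀ n ω, 0 ≤ a n ω)
    {c : ℝ} (hc : 0 ≤ c) (N n : ℕ) : ∀ {ω : Ω}, SubadditiveOn T a ω →
      a n ω ≤ c * n + ∑ i ∈ Finset.range n, coverCost T a c N n i ω := by
  induction n using Nat.strong_induction_on with
  | _ n ih =>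
    intro ω h
    by_cases hω : ω ∈ slowSet a c N
    · rcases n with _ | n
      · simp [h0]
      have h1 := h.add_le 1 n
      have h2 := ih n n.lt_succ_self (h.iterate 1)
      rw [add_comm n 1, sum_coverCost_add]
      have h3 : a 1 ω ≤ ∑ i ∈ Finset.range 1, coverCost T a c N (1 + n) i ω := by
        simp only [Finset.sum_range_one, coverCost, Function.iterate_zero, id,
          Set.indicator_of_mem hω]
        split_ifs
        · linarith [hnn 1 ω]
        · linarith
      push_cast
      linarith
    · simp only [slowSet, Set.mem_ofPred_eq, not_forall, not_lt] at hω
      obtain ⟨k, hk1, hkN, hk⟩ := hω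
      rcases le_or_gt k n with hkn | hkn
      · obtain ⟨m, rfl⟩ := Nat.exists_eq_add_of_le hkn
        have h1 := h.add_le k m
        have h2 := ih m (by omega) (h.iterate k)
        rw [sum_coverCost_add]
        have h3 : 0 ≤ ∑ i ∈ Finset.range k, coverCost T a c N (k + m) i ω :=
          Finset.sum_nonneg fun _ _ => coverCost_nonneg hnn _ _ _ _ _
        push_cast
        linarith
      · refine (h.le_sum_one h0 n).trans ?_
        have h1 : ∑ i ∈ Finset.range n, a 1 (T^[i] ω) ≤
            ∑ i ∈ Finset.range n, coverCost T a c N n i ω := by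
          refine Finset.sum_le_sum fun i _ => ?_
          rw [coverCost, if_pos (by omega)]
          linarith [(slowSet a c N).indicator_nonneg (f := a 1) (fun _ _ => hnn _ _) (T^[i] ω)]
        have : 0 ≤ c * n := by positivity
        linarith

variable [MeasurableSpace Ω] {P : Measure Ω}

lemma ae_subadditiveOn (hT : MeasurePreserving T P P)
    (hsub : ∀ᵐ ω ∂P, ∀ m n, a (m + n) ω ≤ a m ω + a n (T^[m] ω)) :
    ∀ᵐ ω ∂P, SubadditiveOn T a ω := by
  refine ae_all_iff.2 fun i => ?_
  filter_upwards [(hT.iterate i).quasiMeasurePreserving.ae hsub] with ω hω m n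
  have := hω m n
  rwa [← Function.iterate_add_apply, add_comm m i] at this

lemma integrable_of_ae_subadditive (hT : MeasurePreserving T P P) (h0 : ∀ ω, a 0 ω = 0)
    (hnn : ∀ n ω, 0 ≤ a n ω) (hmeas : ∀ n, Measurable (a n)) (hint : Integrable (a 1) P)
    (hsub : ∀ᵐ ω ∂P, ∀ m n, a (m + n) ω ≤ a m ω + a n (T^[m] ω)) (n : ℕ) :
    Integrable (a n) P := by
  have hs : Integrable (fun ω => ∑ j ∈ Finset.range n, a 1 (T^[j] ω)) P :=
    integrable_finsetSum _ fun j _ => (hT.iterate j).integrable_comp_of_integrable hint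
  refine hs.mono' (hmeas n).aestronglyMeasurable ?_
  filter_upwards [ae_subadditiveOn hT hsub] with ω hω
  rw [Real.norm_of_nonneg (hnn n ω)]
  exact hω.le_sum_one h0 n

lemma integral_comp_iterate (hT : MeasurePreserving T P P) (k : ℕ) {f : Ω → ℝ}
    (hf : Measurable f) : ∫ ω, f (T^[k] ω) ∂P = ∫ ω, f ω ∂P := by
  have h := (hT.iterate k)
  conv_rhs => rw [← h.map_eq]
  rw [integral_map h.measurable.aemeasurable hf.aestronglyMeasurable]

lemma subadditive_integral (hT : MeasurePreserving T P P) (h0 : ∀ ω, a 0 ω = 0)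
    (hnn : ∀ n ω, 0 ≤ a n ω) (hmeas : ∀ n, Measurable (a n)) (hint : Integrable (a 1) P)
    (hsub : ∀ᵐ ω ∂P, ∀ m n, a (m + n) ω ≤ a m ω + a n (T^[m] ω)) :
    Subadditive fun n => ∫ ω, a n ω ∂P := by
  intro m n
  have hi := integrable_of_ae_subadditive hT h0 hnn hmeas hint hsub
  have hi' : Integrable (fun ω => a n (T^[m] ω)) P :=
    (hT.iterate m).integrable_comp_of_integrable (hi n)
  calc ∫ ω, a (m + n) ω ∂P ≤ ∫ ω, (a m ω + a n (T^[m] ω)) ∂P := by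
        refine integral_mono_ae (hi _) ((hi m).add hi') ?_
        filter_upwards [hsub] with ω hω using hω m n
    _ = _ := by rw [integral_add (hi m) hi', integral_comp_iterate hT m (hmeas n)]

lemma measurableSet_slowSet (hmeas : ∀ n, Measurable (a n)) (c : ℝ) (N : ℕ) :
    MeasurableSet (slowSet a c N) := by
  simp only [slowSet, Set.ofPred_forall]
  exact MeasurableSet.iInter fun n => MeasurableSet.iInter fun _ => MeasurableSet.iInter fun _ =>
    measurableSet_lt measurable_const (hmeas n)

/-- Integrated form of the covering argument. -/
lemma integral_le_covering [IsProbabilityMeasure P] (hT : MeasurePreserving T P P)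
    (h0 : ∀ ω, a 0 ω = 0)
    (hnn : ∀ n ω, 0 ≤ a n ω) (hmeas : ∀ n, Measurable (a n)) (hint : Integrable (a 1) P)
    (hsub : ∀ᵐ ω ∂P, ∀ m n, a (m + n) ω ≤ a m ω + a n (T^[m] ω)) {c : ℝ} (hc : 0 ≤ c)
    (N n : ℕ) :
    ∫ ω, a n ω ∂P ≤ n * (c + ∫ ω, (slowSet a c N).indicator (a 1) ω ∂P) +
      N * ∫ ω, a 1 ω ∂P := by
  classical
  have hi := integrable_of_ae_subadditive hT h0 hnn hmeas hint hsub
  have hB := measurableSet_slowSet hmeas c N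
  have hf : Measurable ((slowSet a c N).indicator (a 1)) := (hmeas 1).indicator hB
  have hI1 (i : ℕ) : Integrable (fun ω => (slowSet a c N).indicator (a 1) (T^[i] ω)) P :=
    (hT.iterate i).integrable_comp_of_integrable (hint.indicator hB)
  have hI2 (i : ℕ) : Integrable (fun ω => if n ≤ i + N then a 1 (T^[i] ω) else 0) P := by
    split_ifs
    · exact (hT.iterate i).integrable_comp_of_integrable hint
    · exact integrable_zero _ _ _
  have hI (i : ℕ) : Integrable (coverCost T a c N n i) P := (hI1 i).add (hI2 i)
  have hm0 : 0 ≤ ∫ ω, a 1 ω ∂P := integral_nonneg (hnn 1)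
  have key : ∀ i, ∫ ω, coverCost T a c N n i ω ∂P =
      ∫ ω, (slowSet a c N).indicator (a 1) ω ∂P +
        if n ≤ i + N then ∫ ω, a 1 ω ∂P else 0 := by
    intro i
    simp only [coverCost]
    rw [integral_add (hI1 i) (hI2 i), integral_comp_iterate hT i hf]
    split_ifs
    · rw [integral_comp_iterate hT i (hmeas 1)]
    · simp
  calc ∫ ω, a n ω ∂P
      ≤ ∫ ω, (c * n + ∑ i ∈ Finset.range n, coverCost T a c N n i ω) ∂P := by
        refine integral_mono_ae (hi n)
          ((integrable_const _).add (integrable_finsetSum _ fun i _ => hI i)) ?_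
        filter_upwards [ae_subadditiveOn hT hsub] with ω hω
        exact SubadditiveOn.le_add_sum_coverCost h0 hnn hc N n hω
    _ = c * n + ∑ i ∈ Finset.range n, ∫ ω, coverCost T a c N n i ω ∂P := by
        rw [integral_add (integrable_const _) (integrable_finsetSum _ fun i _ => hI i),
          integral_finsetSum _ fun i _ => hI i]
        simp
    _ = n * (c + ∫ ω, (slowSet a c N).indicator (a 1) ω ∂P) +
          ∑ i ∈ Finset.range n, if n ≤ i + N then ∫ ω, a 1 ω ∂P else 0 := by
        simp only [key, Finset.sum_add_distrib, Finset.sum_const, Finset.card_range, nsmul_eq_mul]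
        ring
    _ ≤ _ := by
        gcongr
        rw [← Finset.sum_filter, Finset.sum_const, nsmul_eq_mul]
        gcongr
        -- the remaining sites form the interval `[n - N, n)`
        calc (Finset.filter (fun i => n ≤ i + N) (Finset.range n)).card
            ≤ (Finset.Ico (n - N) n).card := by
              refine Finset.card_le_card fun i hi => ?_
              simp only [Finset.mem_filter, Finset.mem_range, Finset.mem_Ico] at hi ⊢
              omega
          _ ≤ N := by rw [Nat.card_Ico]; omega

/-- If almost every orbit has an initial block of average at most `c`, then the growth rate of the
means is at most `c`. -/
lemma rate_le_of_ae_exists [IsProbabilityMeasure P] (hT : MeasurePreserving T P P)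
    (h0 : ∀ ω, a 0 ω = 0)
    (hnn : ∀ n ω, 0 ≤ a n ω) (hmeas : ∀ n, Measurable (a n)) (hint : Integrable (a 1) P)
    (hsub : ∀ᵐ ω ∂P, ∀ m n, a (m + n) ω ≤ a m ω + a n (T^[m] ω)) {c h : ℝ} (hc : 0 ≤ c)
    (hh : ∀ n : ℕ, h * n ≤ ∫ ω, a n ω ∂P)
    (hex : ∀ᵐ ω ∂P, ∃ n : ℕ, 1 ≤ n ∧ a n ω ≤ c * n) : h ≤ c := by
  set f : ℕ → ℝ := fun N => ∫ ω, (slowSet a c N).indicator (a 1) ω ∂P with hf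
  have hf0 : Tendsto f atTop (𝓝 0) := by
    rw [← integral_zero Ω ℝ (μ := P)]
    refine tendsto_integral_of_dominated_convergence (a 1)
      (fun N => ((hmeas 1).indicator (measurableSet_slowSet hmeas c N)).aestronglyMeasurable)
      hint (fun N => ae_of_all _ fun ω => ?_) ?_
    · rw [Real.norm_of_nonneg (Set.indicator_nonneg (fun _ _ => hnn _ _) _)]
      exact Set.indicator_le_self' (fun _ _ => hnn 1 _) ω
    · filter_upwards [hex] with ω hω
      obtain ⟨n, hn1, hn⟩ := hω
      refine tendsto_const_nhds.congr' ?_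
      filter_upwards [eventually_ge_atTop n] with N hN
      rw [Set.indicator_of_notMem]
      exact fun hmem => (hmem n hn1 hN).not_ge hn
  have hle (N : ℕ) : h ≤ c + f N := by
    by_contra! hlt
    obtain ⟨n, hn⟩ := exists_nat_gt ((N * ∫ ω, a 1 ω ∂P) / (h - (c + f N)))
    rw [div_lt_iff₀ (by linarith)] at hn
    have h1 := integral_le_covering hT h0 hnn hmeas hint hsub hc N n
    have h2 := hh n
    simp only [hf] at hn hlt
    nlinarith
  have := ge_of_tendsto' (hf0.const_add c) hle
  simpa using this

/-- For an ergodic transformation, a value `c` below the growth rate of the means is almost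
surely exceeded by `a n / n` from some `n` on. -/
lemma ae_eventually_ge [IsProbabilityMeasure P] (hT : Ergodic T P)
    (h0 : ∀ ω, a 0 ω = 0)
    (hnn : ∀ n ω, 0 ≤ a n ω) (hmeas : ∀ n, Measurable (a n)) (hint : Integrable (a 1) P)
    (hsub : ∀ᵐ ω ∂P, ∀ m n, a (m + n) ω ≤ a m ω + a n (T^[m] ω)) {c h : ℝ}
    (hh : ∀ n : ℕ, h * n ≤ ∫ ω, a n ω ∂P) (hch : c < h) :
    ∀ᵐ ω ∂P, ∀ᶠ n : ℕ in atTop, c * n ≤ a n ω := by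
  rcases lt_or_ge c 0 with hc | hc
  · exact ae_of_all _ fun ω => Eventually.of_forall fun n =>
      (mul_nonpos_of_nonpos_of_nonneg hc.le n.cast_nonneg).trans (hnn n ω)
  -- allowing a bounded error makes the set of slow orbits invariant
  set A : Set Ω := {ω | ∃ C : ℕ, ∃ᶠ n : ℕ in atTop, a n ω < c * n + C} with hA
  have hAm : MeasurableSet A := by
    simp only [hA, Set.ofPred_exists, frequently_atTop, Set.ofPred_forall]
    refine MeasurableSet.iUnion fun C => MeasurableSet.iInter fun m => MeasurableSet.iUnion
      fun n => ?_
    exact (MeasurableSet.const _).inter (measurableSet_lt (hmeas n) measurable_const)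
  have hinv : T ⁻¹' A ≤ᵐ[P] A := by
    filter_upwards [hsub] with ω hω hTω
    obtain ⟨C, hC⟩ := hTω
    obtain ⟨D, hD⟩ := exists_nat_ge (a 1 ω)
    refine ⟨D + C, ?_⟩
    refine (tendsto_add_atTop_nat 1).frequently
      (p := fun n : ℕ => a n ω < c * n + (D + C : ℕ)) (hC.mono fun n hn => ?_)
    have := hω 1 n
    rw [add_comm n 1]
    simp only [Function.iterate_one] at this
    push_cast
    linarith
  rcases hT.ae_empty_or_univ_of_preimage_ae_le hAm.nullMeasurableSet hinv with hE | hE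
  · filter_upwards [hE] with ω hω
    have h1 := not_exists.1 (hω.mp : ω ∉ A) 0
    simpa using h1
  · exfalso
    obtain ⟨c', hc1, hc2⟩ := exists_between hch
    refine hc2.not_ge (rate_le_of_ae_exists hT.toMeasurePreserving h0 hnn hmeas hint hsub
      (hc.trans hc1.le) hh ?_)
    filter_upwards [hE] with ω hω
    obtain ⟨C, hC⟩ : ω ∈ A := hω.mpr trivial
    obtain ⟨n0, hn0⟩ := exists_nat_ge (C / (c' - c))
    obtain ⟨n, hn, hlt⟩ := frequently_atTop.1 hC (n0 + 1)
    refine ⟨n, by omega, ?_⟩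
    rw [div_le_iff₀ (by linarith)] at hn0
    have : (n0 : ℝ) ≤ n := by exact_mod_cast (by omega : n0 ≤ n)
    nlinarith

/-- **Kingman's subadditive ergodic theorem** for non-negative processes, under the assumption that
the averages over consecutive blocks of any fixed length obey a strong law of large numbers. -/
theorem tendsto_of_ae_subadditive [IsProbabilityMeasure P] (hT : Ergodic T P)
    (h0 : ∀ ω, a 0 ω = 0)
    (hnn : ∀ n ω, 0 ≤ a n ω) (hmeas : ∀ n, Measurable (a n)) (hint : Integrable (a 1) P)
    (hsub : ∀ᵐ ω ∂P, ∀ m n, a (m + n) ω ≤ a m ω + a n (T^[m] ω))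
    (hblock : ∀ k, 0 < k → ∀ᵐ ω ∂P,
      Tendsto (fun q : ℕ => (∑ j ∈ Finset.range q, a k (T^[k * j] ω)) / q) atTop
        (𝓝 (∫ ω, a k ω ∂P))) :
    ∃ h : ℝ, 0 ≤ h ∧ h ≤ ∫ ω, a 1 ω ∂P ∧
      Tendsto (fun n : ℕ => (∫ ω, a n ω ∂P) / n) atTop (𝓝 h) ∧
      ∀ᵐ ω ∂P, Tendsto (fun n : ℕ => a n ω / n) atTop (𝓝 h) := by
  have hs := subadditive_integral hT.toMeasurePreserving h0 hnn hmeas hint hsub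
  have hbdd : BddBelow (Set.range fun n : ℕ => (∫ ω, a n ω ∂P) / n) := by
    refine ⟨0, ?_⟩
    rintro _ ⟨n, rfl⟩
    exact div_nonneg (integral_nonneg (hnn n)) n.cast_nonneg
  have hlim := hs.tendsto_lim hbdd
  set h := hs.lim
  have hpos : 0 ≤ h :=
    ge_of_tendsto' hlim fun n => div_nonneg (integral_nonneg (hnn n)) n.cast_nonneg
  have hle (n : ℕ) : h * n ≤ ∫ ω, a n ω ∂P := by
    rcases n.eq_zero_or_pos with rfl | hn
    · simp [h0]
    · rw [← le_div_iff₀ (by exact_mod_cast hn)]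
      exact hs.lim_le_div hbdd hn.ne'
  refine ⟨h, hpos, by simpa using hle 1, hlim, ?_⟩
  have hlow : ∀ᵐ ω ∂P, ∀ c : ℚ, (c : ℝ) < h → ∀ᶠ n : ℕ in atTop, c * n ≤ a n ω :=
    ae_all_iff.2 fun c => by
      by_cases hc : (c : ℝ) < h
      · filter_upwards [ae_eventually_ge hT h0 hnn hmeas hint hsub hle hc] with ω hω _ using hω
      · exact ae_of_all _ fun _ hc' => absurd hc' hc
  have hblock' : ∀ᵐ ω ∂P, ∀ k, 0 < k →
      Tendsto (fun q : ℕ => (∑ j ∈ Finset.range q, a k (T^[k * j] ω)) / q) atTop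
        (𝓝 (∫ ω, a k ω ∂P)) :=
    ae_all_iff.2 fun k => by
      by_cases hk : 0 < k
      · filter_upwards [hblock k hk] with ω hω _ using hω
      · exact ae_of_all _ fun _ hk' => absurd hk' hk
  filter_upwards [hlow, hblock', ae_subadditiveOn hT.toMeasurePreserving hsub] with ω h1 h2 h3
  refine tendsto_order.2 ⟨fun c hc => ?_, fun c hc => ?_⟩
  · obtain ⟨q, hq1, hq2⟩ := exists_rat_btwn hc
    filter_upwards [h1 q hq2, eventually_gt_atTop 0] with n hn hn0
    exact hq1.trans_le ((le_div_iff₀ (by exact_mod_cast hn0)).2 hn)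
  · obtain ⟨c', hc1, hc2⟩ := exists_between hc
    obtain ⟨k, hk, hk0⟩ :=
      ((hlim.eventually_lt_const hc1).and (eventually_gt_atTop 0)).exists
    have hk' : (0 : ℝ) < k := by exact_mod_cast hk0
    have hm := h2 1 one_pos
    simp only [one_mul] at hm
    filter_upwards [h3.eventually_le h0 hnn hk0 (h2 k hk0) hm (hpos.trans hc1.le)
      ((div_lt_iff₀ hk').1 hk), eventually_gt_atTop 0] with n hn hn0
    exact ((div_le_iff₀ (by exact_mod_cast hn0)).2 hn).trans_lt hc2

end Kingman

/-! ### The Bernoulli shift -/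

section Shift

variable {G : Type*}

/-- The shift of the sequence of increments. -/
def shift (ω : ℕ → G) : ℕ → G := fun i => ω (i + 1)

lemma shift_iterate_apply (k : ℕ) (ω : ℕ → G) (i : ℕ) : shift^[k] ω i = ω (i + k) := by
  induction k generalizing ω with
  | zero => rfl
  | succ k ih =>
    rw [Function.iterate_succ_apply, ih]
    simp only [shift]
    congr 1

variable [MeasurableSpace G]

lemma measurable_shift : Measurable (shift : (ℕ → G) → ℕ → G) :=
  measurable_pi_lambda _ fun i => measurable_pi_apply (i + 1)

variable (μ : Measure G) [IsProbabilityMeasure μ]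

instance : IsProbabilityMeasure (pathMeasure μ) := by
  unfold pathMeasure; infer_instance

lemma iIndepFun_coord : iIndepFun (fun (i : ℕ) (ω : ℕ → G) => ω i) (pathMeasure μ) :=
  iIndepFun_infinitePi (P := fun _ : ℕ => μ) (X := fun _ => id) (fun _ => measurable_id)

lemma map_coord (i : ℕ) : (pathMeasure μ).map (fun ω => ω i) = μ :=
  Measure.infinitePi_map_eval (fun _ : ℕ => μ) i

lemma measurePreserving_shift :
    MeasurePreserving (shift : (ℕ → G) → ℕ → G) (pathMeasure μ) (pathMeasure μ) := by
  refine ⟨measurable_shift, ?_⟩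
  have h := ((iIndepFun_coord μ).precomp (add_left_injective 1)).map_fun_eq_infinitePi_map
    (fun i => measurable_pi_apply _)
  simp only [map_coord] at h
  exact h

/-- Invariant events of the shift belong to the tail σ-algebra, so Kolmogorov's zero-one law
applies. -/
lemma ergodic_shift : Ergodic (shift : (ℕ → G) → ℕ → G) (pathMeasure μ) := by
  refine { measurePreserving_shift μ with aeconst_set := fun s hs hinv => ?_ }
  let m : ℕ → MeasurableSpace (ℕ → G) := fun i => MeasurableSpace.comap (fun ω => ω i) inferInstance
  have htail : MeasurableSet[limsup m atTop] s := by
    rw [limsup_eq_iInf_iSup_of_nat]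
    rw [MeasurableSpace.measurableSet_iInf]
    intro n
    have h1 : shift^[n] ⁻¹' s = s := Function.IsFixedPt.preimage_iterate hinv n
    rw [← h1]
    have h2 : Measurable[⨆ i, ⨆ (_ : i ≥ n), m i] (shift^[n] : (ℕ → G) → ℕ → G) := by
      refine @measurable_pi_lambda _ _ _ (⨆ i, ⨆ (_ : i ≥ n), m i) _ _ fun i => ?_
      have h3 : (fun ω : ℕ → G => shift^[n] ω i) = fun ω => ω (i + n) := by
        ext ω; exact shift_iterate_apply n ω i
      rw [h3]
      exact Measurable.mono (comap_measurable _)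
        (le_iSup₂_of_le (f := fun i (_ : i ≥ n) => m i) (i + n) (Nat.le_add_left n i) le_rfl) le_rfl
    exact h2 hs
  have h01 := measure_zero_or_one_of_measurableSet_limsup_atTop (s := m)
    (fun n => (measurable_pi_apply n).comap_le) (iIndepFun_coord μ) htail
  rw [eventuallyConst_set]
  rcases h01 with h | h
  · right
    exact measure_eq_zero_iff_ae_notMem.1 h
  · left
    exact (prob_compl_eq_zero_iff hs).2 h

end Shift

section DependsOn

variable {G β γ : Type*}

lemma exists_comp_of_dependsOn [Nonempty G] {f : (ℕ → G) → β} {s : Finset ℕ} (hf : DependsOn f s) :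
    ∃ g : (s → G) → β, ∀ ω, f ω = g fun i => ω i := by
  have : Nonempty β := ⟨f fun _ => Classical.arbitrary G⟩
  obtain ⟨g, rfl⟩ := dependsOn_iff_exists_comp.1 hf
  exact ⟨g, fun ω => rfl⟩

lemma dependsOn_comp_shift {f : (ℕ → G) → β} {n : ℕ} (hf : DependsOn f (Finset.range n))
    (k : ℕ) : DependsOn (fun ω => f (shift^[k] ω)) (Finset.Ico k (k + n)) := by
  intro ω ω' h
  refine hf fun i hi => ?_
  rw [shift_iterate_apply, shift_iterate_apply]
  refine h _ ?_
  simp only [Finset.coe_range, Set.mem_Iio, Finset.coe_Ico, Set.mem_Ico] at hi ⊢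
  omega

variable [Countable G] [Nonempty G]

lemma countable_range_of_dependsOn {f : (ℕ → G) → β} {s : Finset ℕ} (hf : DependsOn f s) :
    (Set.range f).Countable := by
  obtain ⟨g, hg⟩ := exists_comp_of_dependsOn hf
  refine (Set.countable_range g).mono ?_
  rintro _ ⟨ω, rfl⟩
  exact ⟨_, (hg ω).symm⟩

variable [MeasurableSpace G] [DiscreteMeasurableSpace G]

lemma measurable_of_dependsOn [MeasurableSpace β] {f : (ℕ → G) → β} {s : Finset ℕ}
    (hf : DependsOn f s) : Measurable f := by
  obtain ⟨g, hg⟩ := exists_comp_of_dependsOn hf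
  rw [funext hg]
  exact (Measurable.of_discrete (f := g)).comp
    (measurable_pi_lambda _ fun i => measurable_pi_apply _)

lemma indepFun_of_dependsOn [MeasurableSpace β] [MeasurableSpace γ]
    (μ : Measure G) [IsProbabilityMeasure μ] {f : (ℕ → G) → β} {g : (ℕ → G) → γ}
    {s t : Finset ℕ} (hst : Disjoint s t) (hf : DependsOn f s) (hg : DependsOn g t) :
    IndepFun f g (pathMeasure μ) := by
  obtain ⟨f', hf'⟩ := exists_comp_of_dependsOn hf
  obtain ⟨g', hg'⟩ := exists_comp_of_dependsOn hg
  rw [funext hf', funext hg']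
  exact ((iIndepFun_coord μ).indepFun_finset s t hst fun i => measurable_pi_apply i).comp
    (Measurable.of_discrete (f := f')) (Measurable.of_discrete (f := g'))

/-- The values of `f` on disjoint blocks of `k` increments are independent, so that the strong law
of large numbers applies to them. -/
lemma ae_tendsto_block_average (μ : Measure G) [IsProbabilityMeasure μ] {f : (ℕ → G) → ℝ}
    {k : ℕ} (hf : DependsOn f (Finset.range k)) (hint : Integrable f (pathMeasure μ)) :
    ∀ᵐ ω ∂(pathMeasure μ),
      Tendsto (fun q : ℕ => (∑ j ∈ Finset.range q, f (shift^[k * j] ω)) / q) atTop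
        (𝓝 (∫ ω, f ω ∂(pathMeasure μ))) := by
  have hfm : Measurable f := measurable_of_dependsOn hf
  have hmp (j : ℕ) := (measurePreserving_shift μ).iterate (k * j)
  have := strong_law_ae_real (μ := pathMeasure μ) (fun j ω => f (shift^[k * j] ω))
    (by simpa using hint) ?_ ?_
  · simpa using this
  · intro i j hij
    refine indepFun_of_dependsOn μ ?_ (dependsOn_comp_shift hf _) (dependsOn_comp_shift hf _)
    rw [Finset.disjoint_left]
    intro x hx hy
    simp only [Finset.mem_Ico] at hx hy
    rcases lt_or_gt_of_ne hij with h | h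
    · have := Nat.mul_le_mul_left k (Nat.succ_le_of_lt h)
      rw [Nat.mul_succ] at this
      omega
    · have := Nat.mul_le_mul_left k (Nat.succ_le_of_lt h)
      rw [Nat.mul_succ] at this
      omega
  · intro j
    have h0 : (fun ω : ℕ → G => f (shift^[k * 0] ω)) = f := by ext; simp
    rw [h0]
    refine ⟨(hfm.comp (hmp j).measurable).aemeasurable, hfm.aemeasurable, ?_⟩
    exact (Measure.map_map hfm (hmp j).measurable).symm.trans (by rw [(hmp j).map_eq])

end DependsOn

/-! ### Information and entropy -/

section Information

variable {Ω α β : Type*} [MeasurableSpace Ω] {P : Measure Ω} {Y : Ω → α}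

/-- A discrete random element: countably many values, each taken on a measurable event. No
σ-algebra on the target is involved. -/
structure IsDiscrete (Y : Ω → α) : Prop where
  countable_range : (Set.range Y).Countable
  measurableSet_eq : ∀ y, MeasurableSet {ω | Y ω = y}

/-- The information `-ln p_Y(Y)` carried by the random element `Y`. -/
noncomputable def info (P : Measure Ω) (Y : Ω → α) (ω : Ω) : ℝ :=
  -Real.log (prob P Y (Y ω))

lemma prob_nonneg (y : α) : 0 ≤ prob P Y y := measureReal_nonneg

lemma prob_le_one [IsProbabilityMeasure P] (y : α) : prob P Y y ≤ 1 := measureReal_le_one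

lemma info_nonneg [IsProbabilityMeasure P] (ω : Ω) : 0 ≤ info P Y ω :=
  neg_nonneg.2 (Real.log_nonpos (prob_nonneg _) (prob_le_one _))

lemma prob_comp_le [IsProbabilityMeasure P] (F : α → β) (y : α) :
    prob P Y y ≤ prob P (fun ω => F (Y ω)) (F y) :=
  measureReal_mono fun _ hω => congrArg F hω

namespace IsDiscrete

lemma measurable_comp [MeasurableSpace β] (hY : IsDiscrete Y) (f : α → β) :
    Measurable fun ω => f (Y ω) := by
  intro s _
  have : (fun ω => f (Y ω)) ⁻¹' s = ⋃ y ∈ Set.range Y ∩ f ⁻¹' s, {ω | Y ω = y} := by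
    ext ω
    simp
  rw [this]
  exact MeasurableSet.biUnion (hY.countable_range.mono Set.inter_subset_left)
    fun y _ => hY.measurableSet_eq y

lemma comp (hY : IsDiscrete Y) (F : α → β) : IsDiscrete fun ω => F (Y ω) where
  countable_range := by
    refine (hY.countable_range.image F).mono ?_
    rintro _ ⟨ω, rfl⟩
    exact ⟨Y ω, ⟨ω, rfl⟩, rfl⟩
  measurableSet_eq y := by
    let _ : MeasurableSpace β := ⊤
    exact hY.measurable_comp F (MeasurableSpace.measurableSet_top (s := {y}))

lemma measurable_info (hY : IsDiscrete Y) : Measurable (info P Y) :=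
  hY.measurable_comp fun y => -Real.log (prob P Y y)

lemma lintegral_comp (hY : IsDiscrete Y) (f : α → ℝ≥0∞) :
    ∫⁻ ω, f (Y ω) ∂P = ∑' y, f y * P {ω | Y ω = y} := by
  have hU : (⋃ y ∈ Set.range Y, {ω | Y ω = y}) = Set.univ := by
    ext ω; simp
  rw [← setLIntegral_univ, ← hU, lintegral_biUnion hY.countable_range
    fun y _ => hY.measurableSet_eq y]
  · have h1 (y : α) : ∫⁻ ω in {ω | Y ω = y}, f (Y ω) ∂P = f y * P {ω | Y ω = y} := by
      rw [setLIntegral_congr_fun (g := fun _ => f y) (hY.measurableSet_eq y)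
        (fun ω (hω : Y ω = y) => by simp only [hω]), setLIntegral_const]
    simp only [h1]
    refine tsum_subtype_eq_of_support_subset (f := fun y => f y * P {ω | Y ω = y}) fun y hy => ?_
    by_contra hn
    refine hy ?_
    have : {ω | Y ω = y} = ∅ := by
      ext ω
      simp only [Set.mem_ofPred_eq, Set.mem_empty_iff_false, iff_false]
      exact fun h => hn ⟨ω, h⟩
    simp [this]
  · intro y _ z _ hyz
    rw [Function.onFun, Set.disjoint_left]
    exact fun ω (h1 : Y ω = y) (h2 : Y ω = z) => hyz (h1.symm.trans h2)

lemma ae_prob_pos [IsProbabilityMeasure P] (hY : IsDiscrete Y) :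
    ∀ᵐ ω ∂P, 0 < prob P Y (Y ω) := by
  have : ∀ᵐ ω ∂P, ∀ y ∈ Set.range Y, Y ω = y → 0 < prob P Y y := by
    refine (ae_ball_iff hY.countable_range).2 fun y _ => ?_
    rcases (prob_nonneg (P := P) (Y := Y) y).lt_or_eq with h | h
    · exact ae_of_all _ fun _ _ => h
    · have h0 : P {ω | Y ω = y} = 0 := (measureReal_eq_zero_iff).1 h.symm
      filter_upwards [measure_eq_zero_iff_ae_notMem.1 h0] with ω hω h'
      exact absurd h' hω
  filter_upwards [this] with ω hω using hω _ ⟨ω, rfl⟩ rfl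

/-- Entropy is mean information. -/
lemma entropy_eq_lintegral [IsProbabilityMeasure P] (hY : IsDiscrete Y) :
    entropy P Y = ∫⁻ ω, ENNReal.ofReal (info P Y ω) ∂P := by
  rw [entropy, show (fun ω => ENNReal.ofReal (info P Y ω)) =
    fun ω => (fun y => ENNReal.ofReal (-Real.log (prob P Y y))) (Y ω) from rfl,
    hY.lintegral_comp fun y => ENNReal.ofReal (-Real.log (prob P Y y))]
  refine tsum_congr fun y => ?_
  have : P {ω | Y ω = y} = ENNReal.ofReal (prob P Y y) := (ofReal_measureReal).symm
  rw [this, ← ENNReal.ofReal_mul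
    (neg_nonneg.2 (Real.log_nonpos (prob_nonneg _) (prob_le_one _))), Real.negMulLog]
  congr 1
  ring

lemma ae_info_comp_le [IsProbabilityMeasure P] (hY : IsDiscrete Y) (F : α → β) :
    ∀ᵐ ω ∂P, info P (fun ω => F (Y ω)) ω ≤ info P Y ω := by
  filter_upwards [hY.ae_prob_pos (P := P)] with ω hω
  exact neg_le_neg (Real.log_le_log hω (prob_comp_le F (Y ω)))

lemma entropy_comp_le [IsProbabilityMeasure P] (hY : IsDiscrete Y) (F : α → β) :
    entropy P (fun ω => F (Y ω)) ≤ entropy P Y := by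
  rw [hY.entropy_eq_lintegral, (hY.comp F).entropy_eq_lintegral]
  refine lintegral_mono_ae ?_
  filter_upwards [hY.ae_info_comp_le (P := P) F] with ω hω using ENNReal.ofReal_le_ofReal hω

lemma integrable_info [IsProbabilityMeasure P] (hY : IsDiscrete Y) (hfin : entropy P Y < ⊤) :
    Integrable (info P Y) P := by
  refine ⟨hY.measurable_info.aestronglyMeasurable, ?_⟩
  rw [hasFiniteIntegral_iff_ofReal (ae_of_all _ info_nonneg), ← hY.entropy_eq_lintegral]
  exact hfin

lemma entropy_eq_ofReal_integral [IsProbabilityMeasure P] (hY : IsDiscrete Y)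
    (hint : Integrable (info P Y) P) :
    entropy P Y = ENNReal.ofReal (∫ ω, info P Y ω ∂P) := by
  rw [hY.entropy_eq_lintegral, ofReal_integral_eq_lintegral_ofReal hint (ae_of_all _ info_nonneg)]

lemma tsum_measure_eq [IsProbabilityMeasure P] (hY : IsDiscrete Y) :
    ∑' y, P {ω | Y ω = y} = 1 := by
  simpa using (hY.lintegral_comp (P := P) fun _ => 1).symm

end IsDiscrete

end Information

/-! ### Information growth over blocks of increments -/

section Cocycle

variable {G β : Type*} [Nonempty G] [Countable G] [MeasurableSpace G] [DiscreteMeasurableSpace G]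
  (μ : Measure G) [IsProbabilityMeasure μ]

lemma isDiscrete_of_dependsOn {f : (ℕ → G) → β} {s : Finset ℕ} (hf : DependsOn f s) :
    IsDiscrete f where
  countable_range := countable_range_of_dependsOn hf
  measurableSet_eq y := by
    let _ : MeasurableSpace β := ⊤
    exact measurable_of_dependsOn hf (MeasurableSpace.measurableSet_top (s := {y}))

/-- Independence of the first `m` increments from the next `n` makes the probabilities of the
values of `Z` supermultiplicative. -/
lemma prob_mul_prob_le {Z : ℕ → (ℕ → G) → β} (hdep : ∀ n, DependsOn (Z n) (Finset.range n))
    {m n : ℕ} {F : β → β → β} (hF : ∀ ω, Z (m + n) ω = F (Z m ω) (Z n (shift^[m] ω)))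
    (y z : β) :
    prob (pathMeasure μ) (Z m) y * prob (pathMeasure μ) (Z n) z ≤
      prob (pathMeasure μ) (Z (m + n)) (F y z) := by
  let _ : MeasurableSpace β := ⊤
  have hind := indepFun_of_dependsOn μ (f := Z m) (g := fun ω => Z n (shift^[m] ω))
    (s := Finset.range m) (t := Finset.Ico m (m + n)) (by
      rw [Finset.disjoint_left]
      intro x hx hy
      simp only [Finset.mem_range, Finset.mem_Ico] at hx hy
      omega) (hdep m) (dependsOn_comp_shift (hdep n) m)
  have h1 := hind.measure_inter_preimage_eq_mul {y} {z} (MeasurableSpace.measurableSet_top)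
    (MeasurableSpace.measurableSet_top)
  have h2 : pathMeasure μ ((fun ω => Z n (shift^[m] ω)) ⁻¹' {z}) =
      pathMeasure μ {ω | Z n ω = z} :=
    ((measurePreserving_shift μ).iterate m).measure_preimage
      ((isDiscrete_of_dependsOn (hdep n)).measurableSet_eq z).nullMeasurableSet
  rw [h2] at h1
  rw [prob, prob, prob, measureReal_def, measureReal_def, ← ENNReal.toReal_mul]
  change (pathMeasure μ (Z m ⁻¹' {y}) * _).toReal ≤ _
  rw [← h1]
  refine measureReal_mono (μ := pathMeasure μ) fun ω hω => ?_
  have ha : Z m ω = y := hω.1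
  have hb : Z n (shift^[m] ω) = z := hω.2
  simp [hF, ha, hb]

lemma ae_info_add_le {Z : ℕ → (ℕ → G) → β} (hdep : ∀ n, DependsOn (Z n) (Finset.range n))
    (hcomb : ∀ m n, ∃ F : β → β → β, ∀ ω, Z (m + n) ω = F (Z m ω) (Z n (shift^[m] ω))) :
    ∀ᵐ ω ∂(pathMeasure μ), ∀ m n, info (pathMeasure μ) (Z (m + n)) ω ≤
      info (pathMeasure μ) (Z m) ω + info (pathMeasure μ) (Z n) (shift^[m] ω) := by
  refine ae_all_iff.2 fun m => ae_all_iff.2 fun n => ?_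
  obtain ⟨F, hF⟩ := hcomb m n
  have hn := ((measurePreserving_shift μ).iterate m).quasiMeasurePreserving.ae
    (isDiscrete_of_dependsOn (hdep n)).ae_prob_pos
  filter_upwards [(isDiscrete_of_dependsOn (hdep m)).ae_prob_pos (P := pathMeasure μ), hn]
    with ω h1 h2
  have h3 := Real.log_le_log (mul_pos h1 h2)
    (prob_mul_prob_le μ hdep hF (Z m ω) (Z n (shift^[m] ω)))
  rw [Real.log_mul h1.ne' h2.ne', ← hF] at h3
  simp only [info]
  linarith

/-- The information growth rate of a sequence of random elements that are built from consecutive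
blocks of increments. -/
theorem exists_info_rate {Z : ℕ → (ℕ → G) → β} (hdep : ∀ n, DependsOn (Z n) (Finset.range n))
    (hcomb : ∀ m n, ∃ F : β → β → β, ∀ ω, Z (m + n) ω = F (Z m ω) (Z n (shift^[m] ω)))
    (hfin : entropy (pathMeasure μ) firstStep < ⊤) :
    ∃ h : ℝ≥0, (h : ℝ≥0∞) ≤ entropy (pathMeasure μ) firstStep ∧
      Tendsto (fun n : ℕ => entropy (pathMeasure μ) (Z n) / (n : ℝ≥0∞)) atTop (𝓝 (h : ℝ≥0∞)) ∧
      ∀ᵐ ω ∂(pathMeasure μ),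
        Tendsto (fun n : ℕ => info (pathMeasure μ) (Z n) ω / (n : ℝ)) atTop (𝓝 (h : ℝ)) := by
  have hd (n : ℕ) : IsDiscrete (Z n) := isDiscrete_of_dependsOn (hdep n)
  have hX : IsDiscrete (firstStep : (ℕ → G) → G) :=
    isDiscrete_of_dependsOn (s := {0}) fun ω ω' h => h 0 (by simp)
  obtain ⟨g, hg⟩ : ∃ g : G → β, ∀ ω, Z 1 ω = g (firstStep ω) :=
    ⟨fun x => Z 1 fun _ => x, fun ω => hdep 1 fun i hi => by
      have : i = 0 := by simpa using hi
      rw [this]; rfl⟩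
  have hle : entropy (pathMeasure μ) (Z 1) ≤ entropy (pathMeasure μ) firstStep := by
    rw [funext hg]
    exact hX.entropy_comp_le g
  have h0 (ω : ℕ → G) : info (pathMeasure μ) (Z 0) ω = 0 := by
    have : {ω' | Z 0 ω' = Z 0 ω} = Set.univ := by
      ext ω'
      simpa using hdep 0 (x := ω') (y := ω) (by simp)
    simp [info, prob, this]
  have hsub := ae_info_add_le μ hdep hcomb
  have hmeas (n : ℕ) : Measurable (info (pathMeasure μ) (Z n)) := (hd n).measurable_info
  have hint1 := (hd 1).integrable_info (hle.trans_lt hfin)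
  have hint := integrable_of_ae_subadditive (measurePreserving_shift μ) h0
    (fun _ _ => info_nonneg _) hmeas hint1 hsub
  obtain ⟨h, hpos, hle', hlim, hae⟩ := tendsto_of_ae_subadditive (ergodic_shift μ) h0
    (fun _ _ => info_nonneg _) hmeas hint1 hsub fun k _ =>
      ae_tendsto_block_average μ (k := k)
        (fun ω ω' hω => by simp only [info, hdep k hω]) (hint k)
  lift h to ℝ≥0 using hpos
  refine ⟨h, ?_, ?_, hae⟩
  · refine le_trans ?_ hle
    rw [(hd 1).entropy_eq_ofReal_integral hint1]
    exact ENNReal.ofReal_coe_nnreal.symm.trans_le (ENNReal.ofReal_le_ofReal hle')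
  · rw [← ENNReal.ofReal_coe_nnreal]
    refine (ENNReal.tendsto_ofReal hlim).congr' ?_
    filter_upwards [eventually_gt_atTop 0] with n hn
    rw [ENNReal.ofReal_div_of_pos (by exact_mod_cast hn),
      ← (hd n).entropy_eq_ofReal_integral (hint n), ENNReal.ofReal_natCast]

end Cocycle

/-! ### Forgetting the endpoint -/

section Endpoint

variable {Ω α γ : Type*} [MeasurableSpace Ω] {P : Measure Ω} [IsProbabilityMeasure P]

/-- If `Y` determines a set of at most `K` possible values of `S`, then the inverse conditional
probability of `S` given `Y` has mean at most `K`. -/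
lemma lintegral_prob_ratio_le {Y : Ω → α} {S : Ω → γ} (hYS : IsDiscrete fun ω => (Y ω, S ω))
    (D : α → Set γ) (K : ℕ) (hS : ∀ ω, S ω ∈ D (Y ω)) (hD : ∀ ω, (D (Y ω)).encard ≤ K) :
    ∫⁻ ω, P {ω' | Y ω' = Y ω} / P {ω' | (Y ω', S ω') = (Y ω, S ω)} ∂P ≤ K := by
  have hY : IsDiscrete Y := hYS.comp Prod.fst
  rw [hYS.lintegral_comp fun p => P {ω' | Y ω' = p.1} / P {ω' | (Y ω', S ω') = p}]
  calc ∑' p : α × γ, P {ω' | Y ω' = p.1} / P {ω' | (Y ω', S ω') = p} * P {ω' | (Y ω', S ω') = p}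
      ≤ ∑' p : α × γ, (D p.1).indicator (fun _ => P {ω' | Y ω' = p.1}) p.2 := by
        refine ENNReal.tsum_le_tsum fun p => ?_
        by_cases hp : ∃ ω, (Y ω, S ω) = p
        · obtain ⟨ω, rfl⟩ := hp
          rw [Set.indicator_of_mem (hS ω)]
          rw [mul_comm]
          exact ENNReal.mul_div_le
        · have : {ω' | (Y ω', S ω') = p} = ∅ := by
            ext ω
            simp only [Set.mem_ofPred_eq, Set.mem_empty_iff_false, iff_false]
            exact fun h => hp ⟨ω, h⟩
          simp [this]
    _ = ∑' y, ∑' s, (D y).indicator (fun _ => P {ω' | Y ω' = y}) s :=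
        ENNReal.tsum_prod (f := fun y => (D y).indicator fun _ => P {ω' | Y ω' = y})
    _ ≤ ∑' y, K * P {ω' | Y ω' = y} := by
        refine ENNReal.tsum_le_tsum fun y => ?_
        by_cases hy : ∃ ω, Y ω = y
        · obtain ⟨ω, rfl⟩ := hy
          rw [← tsum_subtype, ENNReal.tsum_set_const]
          gcongr
          exact_mod_cast hD ω
        · have : {ω' | Y ω' = y} = ∅ := by
            ext ω
            simp only [Set.mem_ofPred_eq, Set.mem_empty_iff_false, iff_false]
            exact fun h => hy ⟨ω, h⟩
          simp [this]
    _ = K := by rw [ENNReal.tsum_mul_left, hY.tsum_measure_eq, mul_one]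

/-- If `Y n` determines `S n` up to `n + 1` possibilities, then adjoining `S n` to `Y n` increases
the information by at most `3 ln (n + 1)` from some `n` on. -/
lemma ae_eventually_info_prod_le {Y : ℕ → Ω → α} {S : ℕ → Ω → γ}
    (hYS : ∀ n, IsDiscrete fun ω => (Y n ω, S n ω))
    (D : α → Set γ) (hS : ∀ n ω, S n ω ∈ D (Y n ω))
    (hD : ∀ n ω, (D (Y n ω)).encard ≤ (n + 1 : ℕ)) :
    ∀ᵐ ω ∂P, ∀ᶠ n : ℕ in atTop,
      info P (fun ω => (Y n ω, S n ω)) ω ≤ info P (Y n) ω + 3 * Real.log (n + 1) := by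
  set r : ℕ → Ω → ℝ≥0∞ := fun n ω =>
    P {ω' | Y n ω' = Y n ω} / P {ω' | (Y n ω', S n ω') = (Y n ω, S n ω)} with hr
  have hrm (n : ℕ) : Measurable (r n) :=
    (hYS n).measurable_comp fun p => P {ω' | Y n ω' = p.1} / P {ω' | (Y n ω', S n ω') = p}
  set w : ℕ → ℝ≥0∞ := fun n => ENNReal.ofReal (1 / ((n : ℝ) + 1) ^ 3) with hw
  -- the mean of `r n` is at most `n + 1`, and `∑ (n + 1) / (n + 1) ^ 3` converges
  have hfin : ∫⁻ ω, ∑' n, r n ω * w n ∂P ≠ ⊤ := by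
    rw [lintegral_tsum fun n => ((hrm n).mul_const _).aemeasurable]
    have hle : ∑' n, ∫⁻ ω, r n ω * w n ∂P ≤
        ∑' n : ℕ, ENNReal.ofReal (1 / ((n + 1 : ℕ) : ℝ) ^ 2) := by
      refine ENNReal.tsum_le_tsum fun n => ?_
      rw [lintegral_mul_const _ (hrm n)]
      calc (∫⁻ ω, r n ω ∂P) * w n ≤ (n + 1 : ℕ) * w n := by
            gcongr
            exact lintegral_prob_ratio_le (hYS n) D (n + 1) (hS n) (hD n)
        _ = _ := by
            rw [← ENNReal.ofReal_natCast, hw, ← ENNReal.ofReal_mul (by positivity)]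
            congr 1
            push_cast
            field_simp
    refine ne_top_of_le_ne_top ?_ hle
    exact ((summable_nat_add_iff 1).2
      (Real.summable_one_div_nat_pow.2 one_lt_two)).tsum_ofReal_ne_top
  have hae := ae_lt_top (Measurable.tsum fun n => (hrm n).mul_const _) hfin
  have hpos : ∀ᵐ ω ∂P, ∀ n, 0 < prob P (fun ω => (Y n ω, S n ω)) (Y n ω, S n ω) :=
    ae_all_iff.2 fun n => (hYS n).ae_prob_pos
  filter_upwards [hae, hpos] with ω h1 h2
  have h3 := ENNReal.tendsto_atTop_zero_of_tsum_ne_top h1.ne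
  filter_upwards [h3.eventually_lt_const one_pos] with n hn
  have hYpos : 0 < prob P (Y n) (Y n ω) := (h2 n).trans_le
    (prob_comp_le (P := P) (Y := fun ω => (Y n ω, S n ω)) Prod.fst (Y n ω, S n ω))
  have hr' : r n ω = ENNReal.ofReal
      (prob P (Y n) (Y n ω) / prob P (fun ω => (Y n ω, S n ω)) (Y n ω, S n ω)) := by
    rw [ENNReal.ofReal_div_of_pos (h2 n), prob, prob, ofReal_measureReal, ofReal_measureReal]
  have hn0 : (0 : ℝ) < (n : ℝ) + 1 := by positivity
  have hn3 : (0 : ℝ) < ((n : ℝ) + 1) ^ 3 := by positivity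
  rw [hr', hw, ← ENNReal.ofReal_mul (div_nonneg (prob_nonneg _) (prob_nonneg _)), ENNReal.ofReal_lt_one, mul_one_div,
    div_lt_one hn3, div_lt_iff₀ (h2 n)] at hn
  have h4 := Real.log_le_log hYpos hn.le
  rw [Real.log_mul hn3.ne' (h2 n).ne', Real.log_pow] at h4
  simp only [info]
  push_cast at h4
  linarith

lemma tendsto_log_succ_div : Tendsto (fun n : ℕ => Real.log ((n : ℝ) + 1) / n) atTop (𝓝 0) := by
  have h1 := Real.tendsto_pow_log_div_mul_add_atTop 1 (-1) 1 one_ne_zero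
  have h2 : Tendsto (fun n : ℕ => (n : ℝ) + 1) atTop atTop :=
    tendsto_atTop_add_const_right _ _ tendsto_natCast_atTop_atTop
  refine (h1.comp h2).congr fun n => ?_
  simp

/-- The information rates of `(Y n, S n)` are inherited by `Y n`, if `Y n` determines `S n` up to
`n + 1` possibilities. The lower bound for the entropies is Fatou's lemma. -/
lemma tendsto_of_tendsto_prod {Y : ℕ → Ω → α} {S : ℕ → Ω → γ}
    (hYS : ∀ n, IsDiscrete fun ω => (Y n ω, S n ω))
    (D : α → Set γ) (hS : ∀ n ω, S n ω ∈ D (Y n ω))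
    (hD : ∀ n ω, (D (Y n ω)).encard ≤ (n + 1 : ℕ)) {h : ℝ≥0}
    (hent : Tendsto (fun n : ℕ => entropy P (fun ω => (Y n ω, S n ω)) / (n : ℝ≥0∞)) atTop
      (𝓝 (h : ℝ≥0∞)))
    (hinfo : ∀ᵐ ω ∂P, Tendsto (fun n : ℕ => info P (fun ω => (Y n ω, S n ω)) ω / (n : ℝ)) atTop
      (𝓝 (h : ℝ))) :
    Tendsto (fun n : ℕ => entropy P (Y n) / (n : ℝ≥0∞)) atTop (𝓝 (h : ℝ≥0∞)) ∧
      ∀ᵐ ω ∂P, Tendsto (fun n : ℕ => info P (Y n) ω / (n : ℝ)) atTop (𝓝 (h : ℝ)) := by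
  have hY (n : ℕ) : IsDiscrete (Y n) := (hYS n).comp Prod.fst
  have hae : ∀ᵐ ω ∂P, Tendsto (fun n : ℕ => info P (Y n) ω / (n : ℝ)) atTop (𝓝 (h : ℝ)) := by
    have hle : ∀ᵐ ω ∂P, ∀ n, info P (Y n) ω ≤ info P (fun ω => (Y n ω, S n ω)) ω :=
      ae_all_iff.2 fun n => (hYS n).ae_info_comp_le Prod.fst
    filter_upwards [hinfo, hle, ae_eventually_info_prod_le (P := P) hYS D hS hD] with ω h1 h2 h3
    have h4 := h1.sub (tendsto_log_succ_div.const_mul 3)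
    rw [mul_zero, sub_zero] at h4
    refine tendsto_of_tendsto_of_tendsto_of_le_of_le' h4 h1 ?_ ?_
    · filter_upwards [h3] with n hn
      rw [← mul_div_assoc, ← sub_div]
      gcongr
      linarith
    · exact Eventually.of_forall fun n => div_le_div_of_nonneg_right (h2 n) n.cast_nonneg
  refine ⟨tendsto_of_le_liminf_of_limsup_le ?_ ?_, hae⟩
  · calc (h : ℝ≥0∞) = ∫⁻ _, (h : ℝ≥0∞) ∂P := by simp
      _ = ∫⁻ ω, liminf (fun n : ℕ => ENNReal.ofReal (info P (Y n) ω / n)) atTop ∂P := by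
          refine lintegral_congr_ae ?_
          filter_upwards [hae] with ω hω
          rw [(ENNReal.tendsto_ofReal hω).liminf_eq, ENNReal.ofReal_coe_nnreal]
      _ ≤ liminf (fun n : ℕ => ∫⁻ ω, ENNReal.ofReal (info P (Y n) ω / n) ∂P) atTop :=
          lintegral_liminf_le fun n => ((hY n).measurable_info.div_const _).ennreal_ofReal
      _ = liminf (fun n : ℕ => entropy P (Y n) / (n : ℝ≥0∞)) atTop := by
          refine liminf_congr ?_
          filter_upwards [eventually_gt_atTop 0] with n hn
          have hn' : (0 : ℝ) < n := by exact_mod_cast hn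
          have h1 (ω : Ω) : ENNReal.ofReal (info P (Y n) ω / n) =
              ENNReal.ofReal (info P (Y n) ω) * (n : ℝ≥0∞)⁻¹ := by
            rw [ENNReal.ofReal_div_of_pos hn', ENNReal.ofReal_natCast, div_eq_mul_inv]
          simp only [h1]
          rw [lintegral_mul_const _ (hY n).measurable_info.ennreal_ofReal,
            (hY n).entropy_eq_lintegral, div_eq_mul_inv]
  · rw [← hent.limsup_eq]
    exact limsup_le_limsup (Eventually.of_forall fun n =>
      ENNReal.div_le_div_right ((hYS n).entropy_comp_le Prod.fst) _)

end Endpoint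

/-! ### Range and weighted digraph of the walk -/

section Walk

variable {G : Type*} [Group G]

lemma walk_add (m n : ℕ) (ω : ℕ → G) :
    walk (m + n) ω = walk m ω * walk n (shift^[m] ω) := by
  induction n with
  | zero => simp [walk]
  | succ n ih =>
    rw [← add_assoc, walk, walk, ih, shift_iterate_apply, mul_assoc, add_comm n m]

lemma walk_congr {n : ℕ} {ω ω' : ℕ → G} (h : ∀ i < n, ω i = ω' i) {i : ℕ} (hi : i ≤ n) :
    walk i ω = walk i ω' := by
  induction i with
  | zero => rfl
  | succ i ih => rw [walk, walk, ih (by omega), h i (by omega)]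

lemma walkRange_congr {n : ℕ} {ω ω' : ℕ → G} (h : ∀ i < n, ω i = ω' i) :
    walkRange n ω = walkRange n ω' := by
  ext g
  refine exists_congr fun i => and_congr_right fun hi => ?_
  rw [walk_congr h hi]

lemma walkRange_add (m n : ℕ) (ω : ℕ → G) :
    walkRange (m + n) ω =
      walkRange m ω ∪ {g | (walk m ω)⁻¹ * g ∈ walkRange n (shift^[m] ω)} := by
  ext g
  constructor
  · rintro ⟨i, hi, rfl⟩
    rcases le_or_gt i m with him | him
    · exact Or.inl ⟨i, him, rfl⟩
    · obtain ⟨j, rfl⟩ := Nat.exists_eq_add_of_le him.le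
      refine Or.inr ⟨j, by omega, ?_⟩
      rw [walk_add, inv_mul_cancel_left]
  · rintro (⟨i, hi, rfl⟩ | ⟨j, hj, h⟩)
    · exact ⟨i, by omega, rfl⟩
    · exact ⟨m + j, by omega, by rw [walk_add, h, mul_inv_cancel_left]⟩

lemma walk_mem_walkRange (n : ℕ) (ω : ℕ → G) : walk n ω ∈ walkRange n ω := ⟨n, le_rfl, rfl⟩

lemma encard_walkRange_le (n : ℕ) (ω : ℕ → G) : (walkRange n ω).encard ≤ (n + 1 : ℕ) := by
  classical
  have : walkRange n ω ⊆ ((Finset.range (n + 1)).image fun i => walk i ω : Finset G) := by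
    rintro g ⟨i, hi, rfl⟩
    simp only [Finset.coe_image, Set.mem_image, Finset.coe_range, Set.mem_Iio]
    exact ⟨i, by omega, rfl⟩
  refine (Set.encard_le_encard this).trans ?_
  rw [Set.encard_coe_eq_coe_finsetCard]
  exact_mod_cast Finset.card_image_le.trans (by simp)

/-- The union of a weighted digraph with the left translate by `g` of another one, with weights
added. -/
def WeightedDigraph.glue (g : G) (Γ Γ' : WeightedDigraph G) : WeightedDigraph G where
  verts := Γ.verts ∪ {x | g⁻¹ * x ∈ Γ'.verts}
  edges := Γ.edges ∪ {a | (g⁻¹ * a.1, g⁻¹ * a.2) ∈ Γ'.edges}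
  weight a := Γ.weight a + Γ'.weight (g⁻¹ * a.1, g⁻¹ * a.2)
  edges_subset := by
    rintro a (ha | ha)
    · exact ⟨Or.inl (Γ.edges_subset ha).1, Or.inl (Γ.edges_subset ha).2⟩
    · exact ⟨Or.inr (Γ'.edges_subset ha).1, Or.inr (Γ'.edges_subset ha).2⟩
  weight_eq_zero a ha := by
    rw [Γ.weight_eq_zero a fun h => ha (Or.inl h), Γ'.weight_eq_zero _ fun h => ha (Or.inr h)]

lemma walkDigraph_congr {n : ℕ} {ω ω' : ℕ → G} (h : ∀ i < n, ω i = ω' i) :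
    walkDigraph n ω = walkDigraph n ω' := by
  have h1 (i : ℕ) (hi : i < n) : walk i ω = walk i ω' := walk_congr h hi.le
  have h2 (i : ℕ) (hi : i < n) : walk (i + 1) ω = walk (i + 1) ω' := walk_congr h hi
  ext1
  · exact walkRange_congr h
  · ext a
    refine exists_congr fun i => and_congr_right fun hi => ?_
    rw [h1 i hi, h2 i hi]
  · ext a
    simp only [walkDigraph]
    refine Finset.sum_congr rfl fun i hi => ?_
    rw [h1 i (Finset.mem_range.1 hi), h2 i (Finset.mem_range.1 hi)]

lemma walk_add_eq_iff (m i : ℕ) (ω : ℕ → G) (x : G) :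
    walk (m + i) ω = x ↔ walk i (shift^[m] ω) = (walk m ω)⁻¹ * x := by
  rw [walk_add, eq_inv_mul_iff_mul_eq]

lemma walkDigraph_add (m n : ℕ) (ω : ℕ → G) :
    walkDigraph (m + n) ω =
      WeightedDigraph.glue (walk m ω) (walkDigraph m ω) (walkDigraph n (shift^[m] ω)) := by
  ext1
  · exact walkRange_add m n ω
  · ext a
    constructor
    · rintro ⟨i, hi, h1, h2⟩
      rcases lt_or_ge i m with him | him
      · exact Or.inl ⟨i, him, h1, h2⟩
      · obtain ⟨j, rfl⟩ := Nat.exists_eq_add_of_le him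
        exact Or.inr ⟨j, by omega, (walk_add_eq_iff m j ω _).1 h1,
          (walk_add_eq_iff m (j + 1) ω _).1 h2⟩
    · rintro (⟨i, hi, h⟩ | ⟨j, hj, h1, h2⟩)
      · exact ⟨i, by omega, h⟩
      · exact ⟨m + j, by omega, (walk_add_eq_iff m j ω _).2 h1,
          (walk_add_eq_iff m (j + 1) ω _).2 h2⟩
  · ext a
    simp only [walkDigraph, WeightedDigraph.glue]
    rw [Finset.sum_range_add]
    congr 1
    refine Finset.sum_congr rfl fun j _ => ?_
    congr 1
    exact propext (and_congr (walk_add_eq_iff m j ω _) (walk_add_eq_iff m (j + 1) ω _))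

/-- The four limits for a functional `Y n` of the first `n` steps that is assembled from consecutive
pieces of the path with the help of the walk, and determines the position of the walk up to
`n + 1` possibilities. -/
theorem exists_rate_of_walk_functional {β : Type*} [Countable G] [MeasurableSpace G]
    [DiscreteMeasurableSpace G] (μ : Measure G) [IsProbabilityMeasure μ]
    (hfin : entropy (pathMeasure μ) firstStep < ⊤) (Y : ℕ → (ℕ → G) → β)
    (hcongr : ∀ (n : ℕ) (ω ω' : ℕ → G), (∀ i < n, ω i = ω' i) → Y n ω = Y n ω')
    (F : G → β → β → β)
    (hF : ∀ m n ω, Y (m + n) ω = F (walk m ω) (Y m ω) (Y n (shift^[m] ω)))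
    (D : β → Set G) (hS : ∀ n ω, walk n ω ∈ D (Y n ω))
    (hD : ∀ n ω, (D (Y n ω)).encard ≤ (n + 1 : ℕ)) :
    ∃ h : ℝ≥0, (h : ℝ≥0∞) ≤ entropy (pathMeasure μ) firstStep ∧
      Tendsto (fun n : ℕ => entropy (pathMeasure μ) (Y n) / (n : ℝ≥0∞)) atTop (𝓝 (h : ℝ≥0∞)) ∧
      Tendsto (fun n : ℕ => entropy (pathMeasure μ) (fun ω => (Y n ω, walk n ω)) / (n : ℝ≥0∞))
        atTop (𝓝 (h : ℝ≥0∞)) ∧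
      (∀ᵐ ω ∂(pathMeasure μ),
        Tendsto (fun n : ℕ => info (pathMeasure μ) (Y n) ω / (n : ℝ)) atTop (𝓝 (h : ℝ))) ∧
      (∀ᵐ ω ∂(pathMeasure μ),
        Tendsto (fun n : ℕ => info (pathMeasure μ) (fun ω => (Y n ω, walk n ω)) ω / (n : ℝ))
          atTop (𝓝 (h : ℝ))) := by
  have hdep (n : ℕ) : DependsOn (fun ω : ℕ → G => (Y n ω, walk n ω)) (Finset.range n) := by
    intro ω ω' h
    have h' : ∀ i < n, ω i = ω' i := fun i hi => h i (by simpa using hi)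
    exact Prod.ext (hcongr n ω ω' h') (walk_congr h' le_rfl)
  obtain ⟨h, h1, h2, h3⟩ := exists_info_rate μ (Z := fun n ω => (Y n ω, walk n ω)) hdep
    (fun m n => ⟨fun p q => (F p.2 p.1 q.1, p.2 * q.2), fun ω =>
      Prod.ext (hF m n ω) (walk_add m n ω)⟩) hfin
  obtain ⟨h4, h5⟩ := tendsto_of_tendsto_prod (fun n => isDiscrete_of_dependsOn (hdep n)) D hS hD
    h2 h3
  exact ⟨h, h1, h4, h2, h5, h3⟩

end Walk

end RangeEntropy

theorem theorem1p1 {G : Type*} [Group G] [Countable G] [MeasurableSpace G]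
    [DiscreteMeasurableSpace G] (μ : Measure G) [IsProbabilityMeasure μ]
    (hgen : Subgroup.closure {g : G | μ {g} ≠ 0} = ⊤)
    (hpos : 0 < RangeEntropy.entropy (RangeEntropy.pathMeasure μ) RangeEntropy.firstStep)
    (hfin : RangeEntropy.entropy (RangeEntropy.pathMeasure μ) RangeEntropy.firstStep < ⊤) :
    (∃ h : ℝ≥0,
      (h : ℝ≥0∞) ≤ RangeEntropy.entropy (RangeEntropy.pathMeasure μ) RangeEntropy.firstStep ∧
      Tendsto (fun n : ℕ =>
          RangeEntropy.entropy (RangeEntropy.pathMeasure μ) (RangeEntropy.walkRange n) /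
            (n : ℝ≥0∞))
        atTop (𝓝 (h : ℝ≥0∞)) ∧
      Tendsto (fun n : ℕ =>
          RangeEntropy.entropy (RangeEntropy.pathMeasure μ)
            (fun ω => (RangeEntropy.walkRange n ω, RangeEntropy.walk n ω)) / (n : ℝ≥0∞))
        atTop (𝓝 (h : ℝ≥0∞)) ∧
      (∀ᵐ ω ∂(RangeEntropy.pathMeasure μ), Tendsto (fun n : ℕ =>
          -Real.log (RangeEntropy.prob (RangeEntropy.pathMeasure μ) (RangeEntropy.walkRange n)
            (RangeEntropy.walkRange n ω)) / (n : ℝ))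
        atTop (𝓝 (h : ℝ))) ∧
      (∀ᵐ ω ∂(RangeEntropy.pathMeasure μ), Tendsto (fun n : ℕ =>
          -Real.log (RangeEntropy.prob (RangeEntropy.pathMeasure μ)
            (fun ω' => (RangeEntropy.walkRange n ω', RangeEntropy.walk n ω'))
            (RangeEntropy.walkRange n ω, RangeEntropy.walk n ω)) / (n : ℝ))
        atTop (𝓝 (h : ℝ)))) ∧
    (∃ h : ℝ≥0,
      (h : ℝ≥0∞) ≤ RangeEntropy.entropy (RangeEntropy.pathMeasure μ) RangeEntropy.firstStep ∧
      Tendsto (fun n : ℕ =>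
          RangeEntropy.entropy (RangeEntropy.pathMeasure μ) (RangeEntropy.walkDigraph n) /
            (n : ℝ≥0∞))
        atTop (𝓝 (h : ℝ≥0∞)) ∧
      Tendsto (fun n : ℕ =>
          RangeEntropy.entropy (RangeEntropy.pathMeasure μ)
            (fun ω => (RangeEntropy.walkDigraph n ω, RangeEntropy.walk n ω)) / (n : ℝ≥0∞))
        atTop (𝓝 (h : ℝ≥0∞)) ∧
      (∀ᵐ ω ∂(RangeEntropy.pathMeasure μ), Tendsto (fun n : ℕ =>
          -Real.log (RangeEntropy.prob (RangeEntropy.pathMeasure μ) (RangeEntropy.walkDigraph n)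
            (RangeEntropy.walkDigraph n ω)) / (n : ℝ))
        atTop (𝓝 (h : ℝ))) ∧
      (∀ᵐ ω ∂(RangeEntropy.pathMeasure μ), Tendsto (fun n : ℕ =>
          -Real.log (RangeEntropy.prob (RangeEntropy.pathMeasure μ)
            (fun ω' => (RangeEntropy.walkDigraph n ω', RangeEntropy.walk n ω'))
            (RangeEntropy.walkDigraph n ω, RangeEntropy.walk n ω)) / (n : ℝ))
        atTop (𝓝 (h : ℝ)))) :=
  ⟨RangeEntropy.exists_rate_of_walk_functional μ hfin RangeEntropy.walkRange
      (fun _ _ _ => RangeEntropy.walkRange_congr) (fun g R R' => R ∪ {x | g⁻¹ * x ∈ R'})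
      RangeEntropy.walkRange_add id RangeEntropy.walk_mem_walkRange
      RangeEntropy.encard_walkRange_le,
    RangeEntropy.exists_rate_of_walk_functional μ hfin RangeEntropy.walkDigraph
      (fun _ _ _ => RangeEntropy.walkDigraph_congr) RangeEntropy.WeightedDigraph.glue
      RangeEntropy.walkDigraph_add RangeEntropy.WeightedDigraph.verts
      RangeEntropy.walk_mem_walkRange RangeEntropy.encard_walkRange_le⟩
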